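/- Let $\mathcal H$ be a finite-dimensional complex Hilbert space and $S$ a finite set. Let $Q(s,t)$ ($s,t\in S$) be completely positive, trace-nonincreasing super-operators on $\mathcal H$ such that for each $s\in S$ the super-operator $\sum_{t\in S}Q(s,t)$ is trace-preserving (a quantum Markov chain). Put $\mathcal H_{\mathrm{cq}}=\mathcal C\otimes\mathcal H$, where $\mathcal C$ has the orthonormal basis $\{|s\rangle:s\in S\}$. Let $\mathcal F=\sum_{s,t\in S}\{|t\rangle\langle s|\}\otimes Q(s,t)$, that is, $\mathcal F(M)=\sum_{s,t}|t\rangle\langle t|\otimes Q(s,t)\big((\langle s|\otimes I)M(|s\rangle\otimes I)\big)$. For a property $\Phi$ of states let $\mathcal P_\Phi(M)=P_\Phi M P_\Phi$ with $P_\Phi=\sum_{s\models\Phi}|s\rangle\langle s|\otimes I$. Let $\Phi_1,\Phi_2$ be arbitrary properties of states (each is given by the set of states that satisfy it) and let $\mathcal F_{\Phi_1\wedge\neg\Phi_2}=\mathcal F\circ\mathcal P_{\Phi_1\wedge\neg\Phi_2}$. The support $\mathrm{supp}(\gamma)$ of a Hermitian operator $\gamma$ is the span of its eigenvectors with nonzero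 eigenvalue. For a completely positive super-operator $\mathcal E$ a subspace $B$ is bottom if $\mathrm{supp}(\mathcal E(|\psi\rangle\langle\psi|))\subseteq B$ for all unit vectors $\psi\in B$; it is an SCC if for all unit vectors $\psi_1,\psi_2\in B$ we have $\psi_2\in\mathrm{span}\big(\bigcup_{i\ge0}\mathrm{supp}(\mathcal E^i(|\psi_1\rangle\langle\psi_1|))\big)$; it is a BSCC subspace if it is both. Call a BSCC subspace $B$ proper if it is not annihilated by $\mathcal E$, i.e. $\mathcal E(|\psi\rangle\langle\psi|)\neq0$ for some unit vector $\psi\in B$. Let $\gamma_1,\dots,\gamma_m$ be a basis of the real vector space of Hermitian solutions of $\mathcal F_{\Phi_1\wedge\neg\Phi_2}(\gamma)=\gamma$. Then the direct sum of all proper BSCC subspaces with respect to $\mathcal F_{\Phi_1\wedge\neg\Phi_2}$ is $\Gamma=\mathrm{span}\big(\bigcup_{i=1}^m\mathrm{supp}(\gamma_i)\big)$. Precisely: 1. the sum of all proper BSCC subspaces is $\Gamma$; 2. $\Gamma$ is the orthogonal direct sum of finitely many proper BSCC subspaces; 3. every maximal family of pairwise orthogonal proper BSCC subspaces has direct sum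 $\Gamma$. -/

import Mathlib

open scoped ComplexOrder Kronecker

noncomputable section

namespace QMarkov

/-- Super-operators on the Hilbert space `ℂⁿ` (with `n` a finite index type): linear maps on the
space of linear operators, the latter written as matrices in the standard orthonormal basis. -/
abbrev SuperOp (n : Type*) := Module.End ℂ (Matrix n n ℂ)

section General

variable {n : Type*} [Fintype n] [DecidableEq n]

/-- The trivial extension `ℰ ⊗ ℐ` of a super-operator to `ℂⁿ ⊗ ℂᵏ`: the map `ℰ` is applied to
each of the `k × k` blocks `M_{ij}` of `M = ∑ M_{ij} ⊗ |i⟩⟨j|`. -/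
def extend (E : SuperOp n) (k : ℕ) (M : Matrix (n × Fin k) (n × Fin k) ℂ) :
    Matrix (n × Fin k) (n × Fin k) ℂ :=
  fun x y => E (fun a b => M (a, x.2) (b, y.2)) x.1 y.1

/-- Complete positivity: every trivial extension preserves positive operators. -/
def IsCompletelyPositive (E : SuperOp n) : Prop :=
  ∀ (k : ℕ) (M : Matrix (n × Fin k) (n × Fin k) ℂ), M.PosSemidef → (extend E k M).PosSemidef

/-- Partial density operators: positive operators of trace at most one. -/
def IsPartialDensity (ρ : Matrix n n ℂ) : Prop :=
  ρ.PosSemidef ∧ ρ.trace.re ≤ 1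

/-- The trace pre-order on super-operators. -/
def TraceLE (E₁ E₂ : SuperOp n) : Prop :=
  ∀ ρ : Matrix n n ℂ, IsPartialDensity ρ → (E₁ ρ).trace.re ≤ (E₂ ρ).trace.re

/-- Equivalence with respect to the trace pre-order. -/
def TraceEquiv (E₁ E₂ : SuperOp n) : Prop :=
  TraceLE E₁ E₂ ∧ TraceLE E₂ E₁

/-- The support of an operator: the span of its eigenvectors with nonzero eigenvalue. -/
def supp (γ : Matrix n n ℂ) : Submodule ℂ (EuclideanSpace ℂ n) :=
  Submodule.span ℂ {v | ∃ μ : ℂ, μ ≠ 0 ∧ Matrix.toEuclideanLin γ v = μ • v}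

/-- The operator `|ψ⟩⟨ψ|`. -/
def ketbra (ψ : EuclideanSpace ℂ n) : Matrix n n ℂ :=
  fun a b => ψ a * star (ψ b)

/-- `Γ` is bottom: the image of every pure state in `Γ` is supported in `Γ`. -/
def IsBottom (E : SuperOp n) (Γ : Submodule ℂ (EuclideanSpace ℂ n)) : Prop :=
  ∀ ψ ∈ Γ, ‖ψ‖ = 1 → supp (E (ketbra ψ)) ≤ Γ

/-- `Γ` is strongly connected: each pure state in `Γ` lies in the reachable subspace of each
other one. -/
def IsSCC (E : SuperOp n) (Γ : Submodule ℂ (EuclideanSpace ℂ n)) : Prop :=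
  ∀ ψ₁ ∈ Γ, ∀ ψ₂ ∈ Γ, ‖ψ₁‖ = 1 → ‖ψ₂‖ = 1 →
    ψ₂ ∈ Submodule.span ℂ
      (⋃ i : ℕ, (supp ((E ^ i) (ketbra ψ₁)) : Set (EuclideanSpace ℂ n)))

/-- Bottom strongly connected component subspaces. -/
def IsBSCC (E : SuperOp n) (Γ : Submodule ℂ (EuclideanSpace ℂ n)) : Prop :=
  IsBottom E Γ ∧ IsSCC E Γ

/-- BSCC subspaces that are not annihilated: some pure state in `Γ` has a nonzero image. This
leaves out the zero subspace and the subspaces on which every pure state is mapped to `0`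
(the span of any single vector that is killed satisfies `IsBSCC` vacuously). -/
def IsProperBSCC (E : SuperOp n) (Γ : Submodule ℂ (EuclideanSpace ℂ n)) : Prop :=
  IsBSCC E Γ ∧ ∃ ψ ∈ Γ, ‖ψ‖ = 1 ∧ E (ketbra ψ) ≠ 0

/-- `γ` is a maximal linearly independent (over `ℝ`) family of Hermitian solutions of the
stationary equation `E γ = γ`. -/
structure IsSolutionBasis (E : SuperOp n) {m : ℕ} (γ : Fin m → Matrix n n ℂ) : Prop where
  hermitian : ∀ i, (γ i).IsHermitian
  fixed : ∀ i, E (γ i) = γ i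
  linearIndependent : LinearIndependent ℝ γ
  spanning : ∀ δ : Matrix n n ℂ, δ.IsHermitian → E δ = δ → δ ∈ Submodule.span ℝ (Set.range γ)

end General

/-- The transition structure of a quantum Markov chain with finite state set `S` over the
Hilbert space with orthonormal basis indexed by `ι`. -/
structure QMC (S ι : Type*) [Fintype S] [Fintype ι] [DecidableEq ι] where
  /-- the transition super-operator matrix -/
  Q : S → S → SuperOp ι
  completelyPositive : ∀ s t, IsCompletelyPositive (Q s t)
  traceNonincreasing : ∀ s t, TraceLE (Q s t) 1
  complete : ∀ s, TraceEquiv (∑ t, Q s t) 1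

section QMC

variable {S ι : Type*} [Fintype S] [DecidableEq S] [Fintype ι] [DecidableEq ι]

/-- The block `(⟨s| ⊗ I) M (|s⟩ ⊗ I)`, as a linear map in `M`. -/
def diagBlock (s : S) : Matrix (S × ι) (S × ι) ℂ →ₗ[ℂ] Matrix ι ι ℂ where
  toFun M := fun a b => M (s, a) (s, b)
  map_add' _ _ := rfl
  map_smul' _ _ := rfl

/-- The map `X ↦ |t⟩⟨t| ⊗ X`. -/
def putBlock (t : S) : Matrix ι ι ℂ →ₗ[ℂ] Matrix (S × ι) (S × ι) ℂ where
  toFun X := Matrix.single t t (1 : ℂ) ⊗ₖ X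
  map_add' X Y := Matrix.kronecker_add _ X Y
  map_smul' r X := Matrix.kronecker_smul r _ X

/-- The product super-operator `{|t⟩⟨s|} ⊗ E` on `ℋ_cq = span {|s⟩} ⊗ ℋ`; it sends `M` to
`|t⟩⟨t| ⊗ E (M_{ss})`, where `M_{ss}` is the diagonal block of `M` at `s`. -/
def jump (s t : S) (E : SuperOp ι) : SuperOp (S × ι) :=
  putBlock t ∘ₗ E ∘ₗ diagBlock s

/-- `jump s t E` is the product of `X ↦ |t⟩⟨s| X |s⟩⟨t|` and `E`. -/
theorem jump_kronecker (s t : S) (E : SuperOp ι) (X : Matrix S S ℂ) (Y : Matrix ι ι ℂ) :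
    jump s t E (X ⊗ₖ Y) =
      (Matrix.single t s (1 : ℂ) * X * (Matrix.single t s (1 : ℂ)).conjTranspose) ⊗ₖ E Y := by
  have h1 : diagBlock s (X ⊗ₖ Y) = X s s • Y := by
    ext a b
    change X s s * Y a b = X s s * Y a b
    rfl
  have h2 : Matrix.single t s (1 : ℂ) * X * (Matrix.single t s (1 : ℂ)).conjTranspose
      = X s s • Matrix.single t t (1 : ℂ) := by
    simp [Matrix.conjTranspose_single, Matrix.single_mul_mul_single, Matrix.smul_single]
  simp only [jump, LinearMap.comp_apply, h1, h2, map_smul]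
  exact (Matrix.smul_kronecker (X s s) (Matrix.single t t (1 : ℂ)) (E Y)).symm

/-- The combined super-operator `ℱ = ∑_{s,t} {|t⟩⟨s|} ⊗ Q(s,t)` on `ℋ_cq`. -/
def QMC.combined (C : QMC S ι) : SuperOp (S × ι) :=
  ∑ s, ∑ t, jump s t (C.Q s t)

open Classical in
/-- The projector `∑_{s ⊨ Φ} |s⟩⟨s| ⊗ I`. -/
def stateProjector (Φ : S → Prop) : Matrix (S × ι) (S × ι) ℂ :=
  (∑ s ∈ Finset.univ.filter Φ, Matrix.single s s (1 : ℂ)) ⊗ₖ (1 : Matrix ι ι ℂ)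

/-- The projection super-operator `𝒫_Φ`. -/
def projection (Φ : S → Prop) : SuperOp (S × ι) :=
  LinearMap.mulLeft ℂ (stateProjector Φ) ∘ₗ
    LinearMap.mulRight ℂ (stateProjector Φ).conjTranspose

/-- The super-operator `ℱ_Φ = ℱ ∘ 𝒫_Φ`. -/
def QMC.restricted (C : QMC S ι) (Φ : S → Prop) : SuperOp (S × ι) :=
  C.combined ∘ₗ projection Φ

end QMC

end QMarkov

end

set_option linter.unusedSectionVars false

noncomputable section

namespace QMarkov

/-! ### Supports, spectral projections and the Loewner order -/

section LinearAlgebra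

variable {n : Type*} [Fintype n] [DecidableEq n]

/-! The argument works with stationary supports, that is, supports of positive fixed points of a
positive trace-nonincreasing map `F`. A trace count shows that the positive and negative parts of a
Hermitian fixed point are themselves fixed (`exists_fixed_posSemidef_sub`). Positive fixed points
can be added without cancellation of supports, so the supports of a basis of Hermitian solutions
span the largest stationary support, and this is `Γ`.

Stationary supports and proper BSCC subspaces are linked in both directions. A minimal nonzero
stationary support is a proper BSCC subspace: the space reachable from any of its vectors is
invariant and loses no trace, so it contains a nonzero fixed point
(`IsBottom.exists_isStationarySupport`) and by minimality is everything. Conversely, every proper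
BSCC subspace is a stationary support (`IsProperBSCC.isStationarySupport`). Here the form of the
restricted map matters: its outputs commute with the projector onto the states satisfying the
property, trace is preserved on the range of that projector, and everything on its kernel is killed.
A proper BSCC subspace must lie in the range.

Finally, the orthogonal complement of one stationary support inside another is again one
(`IsStationarySupport.inf_orthogonal`). If a maximal orthogonal family of proper BSCC subspaces did
not fill `Γ`, the complement would contain a further member of the family. -/

theorem toEuclideanLin_mul_apply (A B : Matrix n n ℂ) (x : EuclideanSpace ℂ n) :
    Matrix.toEuclideanLin (A * B) x = Matrix.toEuclideanLin A (Matrix.toEuclideanLin B x) := by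
  simp [Matrix.toLpLin_apply]

theorem isSymmetric_of_isHermitian {A : Matrix n n ℂ} (hA : A.IsHermitian) :
    (Matrix.toEuclideanLin A).IsSymmetric :=
  Matrix.isSymmetric_toEuclideanLin_iff.mpr hA

theorem toEuclideanLin_ketbra (ψ x : EuclideanSpace ℂ n) :
    Matrix.toEuclideanLin (ketbra ψ) x = inner ℂ ψ x • ψ := by
  ext i
  simp only [Matrix.toLpLin_apply, ketbra, Matrix.mulVec, dotProduct, PiLp.inner_apply,
    PiLp.smul_apply, smul_eq_mul, Finset.sum_mul, RCLike.inner_apply]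
  refine Finset.sum_congr rfl fun j _ => ?_
  simp only [RCLike.star_def]
  ring

theorem ketbra_eq_vecMulVec (ψ : EuclideanSpace ℂ n) :
    ketbra ψ = Matrix.vecMulVec ψ.ofLp (star ψ.ofLp) := rfl

theorem posSemidef_ketbra (ψ : EuclideanSpace ℂ n) : (ketbra ψ).PosSemidef :=
  Matrix.posSemidef_vecMulVec_self_star _

theorem ketbra_smul (c : ℂ) (ψ : EuclideanSpace ℂ n) :
    ketbra (c • ψ) = ((‖c‖ ^ 2 : ℝ)) • ketbra ψ := by
  ext i j
  have h : (c * star c : ℂ) = ((‖c‖ ^ 2 : ℝ) : ℂ) := by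
    rw [RCLike.star_def, RCLike.mul_conj]; norm_cast
  simp only [ketbra, Matrix.smul_apply, PiLp.smul_apply, smul_eq_mul, star_mul',
    Complex.real_smul, ← h]
  ring

theorem mul_ketbra_mul (A : Matrix n n ℂ) (ψ : EuclideanSpace ℂ n) :
    A * ketbra ψ * A.conjTranspose = ketbra (Matrix.toEuclideanLin A ψ) := by
  rw [ketbra_eq_vecMulVec, ketbra_eq_vecMulVec, Matrix.mul_vecMulVec, Matrix.vecMulVec_mul,
    Matrix.toLpLin_apply]
  simp [Matrix.star_mulVec]

theorem trace_ketbra (ψ : EuclideanSpace ℂ n) : (ketbra ψ).trace.re = ‖ψ‖ ^ 2 := by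
  rw [EuclideanSpace.norm_sq_eq]
  simp only [Matrix.trace, Matrix.diag, ketbra, Complex.re_sum]
  refine Finset.sum_congr rfl fun j _ => ?_
  rw [RCLike.star_def, RCLike.mul_conj]
  norm_cast

theorem inner_nonneg_of_posSemidef {A : Matrix n n ℂ} (hA : A.PosSemidef)
    (x : EuclideanSpace ℂ n) : 0 ≤ (inner ℂ x (Matrix.toEuclideanLin A x)).re :=
  (Matrix.isPositive_toEuclideanLin_iff.mpr hA).re_inner_nonneg_right x

theorem posSemidef_of_inner_nonneg {A : Matrix n n ℂ} (hA : A.IsHermitian)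
    (h : ∀ x, 0 ≤ (inner ℂ x (Matrix.toEuclideanLin A x)).re) : A.PosSemidef := by
  rw [← Matrix.isPositive_toEuclideanLin_iff]
  refine ⟨isSymmetric_of_isHermitian hA, fun x => ?_⟩
  rw [inner_re_symm]
  exact h x

theorem supp_le_range (A : Matrix n n ℂ) : supp A ≤ LinearMap.range (Matrix.toEuclideanLin A) := by
  refine Submodule.span_le.mpr ?_
  rintro v ⟨μ, hμ, hv⟩
  refine ⟨μ⁻¹ • v, ?_⟩
  rw [map_smul, hv, smul_smul, inv_mul_cancel₀ hμ, one_smul]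

theorem toEuclideanLin_eigenvectorBasis {A : Matrix n n ℂ} (hA : A.IsHermitian) (i : n) :
    Matrix.toEuclideanLin A (hA.eigenvectorBasis i)
      = (hA.eigenvalues i : ℂ) • hA.eigenvectorBasis i := by
  ext j
  have h := congrFun (hA.mulVec_eigenvectorBasis i) j
  simpa [Matrix.toLpLin_apply] using h

theorem toEuclideanLin_eq_sum {A : Matrix n n ℂ} (hA : A.IsHermitian) (x : EuclideanSpace ℂ n) :
    Matrix.toEuclideanLin A x
      = ∑ i, inner ℂ (hA.eigenvectorBasis i) x •
        (hA.eigenvalues i : ℂ) • hA.eigenvectorBasis i := by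
  conv_lhs => rw [← hA.eigenvectorBasis.sum_repr' x]
  simp only [map_sum, map_smul, toEuclideanLin_eigenvectorBasis]

theorem eq_sum_ketbra {A : Matrix n n ℂ} (hA : A.IsHermitian) :
    A = ∑ i, hA.eigenvalues i • ketbra (hA.eigenvectorBasis i) := by
  apply Matrix.toEuclideanLin.injective
  ext1 x
  rw [toEuclideanLin_eq_sum hA, map_sum, LinearMap.sum_apply]
  refine Finset.sum_congr rfl fun i _ => ?_
  rw [← Complex.coe_smul, map_smul, LinearMap.smul_apply, toEuclideanLin_ketbra, smul_comm]

theorem eigenvectorBasis_mem_supp {A : Matrix n n ℂ} (hA : A.IsHermitian) {i : n}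
    (hi : hA.eigenvalues i ≠ 0) : hA.eigenvectorBasis i ∈ supp A :=
  Submodule.subset_span ⟨hA.eigenvalues i, by exact_mod_cast hi,
    toEuclideanLin_eigenvectorBasis hA i⟩

theorem supp_eq_range {A : Matrix n n ℂ} (hA : A.IsHermitian) :
    supp A = LinearMap.range (Matrix.toEuclideanLin A) := by
  refine le_antisymm (supp_le_range A) ?_
  rintro _ ⟨x, rfl⟩
  rw [toEuclideanLin_eq_sum hA]
  refine Submodule.sum_mem _ fun i _ => Submodule.smul_mem _ _ ?_
  by_cases hi : hA.eigenvalues i = 0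
  · simp [hi]
  · exact Submodule.smul_mem _ _ (eigenvectorBasis_mem_supp hA hi)

theorem orthogonal_supp {A : Matrix n n ℂ} (hA : A.IsHermitian) {x : EuclideanSpace ℂ n} :
    x ∈ (supp A)ᗮ ↔ Matrix.toEuclideanLin A x = 0 := by
  rw [supp_eq_range hA, (isSymmetric_of_isHermitian hA).orthogonal_range, LinearMap.mem_ker]

theorem supp_le_supp_of_ker {A B : Matrix n n ℂ} (hA : A.IsHermitian) (hB : B.IsHermitian)
    (h : ∀ x, Matrix.toEuclideanLin B x = 0 → Matrix.toEuclideanLin A x = 0) :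
    supp A ≤ supp B := by
  rw [← Submodule.orthogonal_le_orthogonal_iff]
  intro x hx
  exact (orthogonal_supp hA).mpr (h x ((orthogonal_supp hB).mp hx))

/-- In an eigenbasis the quadratic form is a sum of nonnegative terms, so it vanishes only if each
term does. -/
theorem inner_eq_zero_iff {A : Matrix n n ℂ} (hA : A.PosSemidef) (x : EuclideanSpace ℂ n) :
    (inner ℂ x (Matrix.toEuclideanLin A x)).re = 0 ↔ Matrix.toEuclideanLin A x = 0 := by
  constructor
  · intro h
    rw [toEuclideanLin_eq_sum hA.1] at h ⊢
    rw [inner_sum, Complex.re_sum, Finset.sum_eq_zero_iff_of_nonneg] at h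
    · refine Finset.sum_eq_zero fun i hi => ?_
      have h1 := h i hi
      rw [inner_smul_right, inner_smul_right, ← inner_conj_symm x, mul_left_comm,
        RCLike.mul_conj, Complex.re_ofReal_mul] at h1
      rcases mul_eq_zero.mp h1 with h2 | h2
      · simp [h2]
      · have : inner ℂ (hA.1.eigenvectorBasis i) x = 0 := by
          have h3 : ‖inner ℂ (hA.1.eigenvectorBasis i) x‖ ^ 2 = 0 := by exact_mod_cast h2
          simpa using h3
        simp [this]
    · intro i _
      rw [inner_smul_right, inner_smul_right, ← inner_conj_symm x, mul_left_comm,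
        RCLike.mul_conj, Complex.re_ofReal_mul]
      refine mul_nonneg (hA.eigenvalues_nonneg i) ?_
      change 0 ≤ (((‖inner ℂ (hA.1.eigenvectorBasis i) x‖ : ℝ) : ℂ) ^ 2).re
      rw [← Complex.ofReal_pow, Complex.ofReal_re]
      positivity
  · intro h
    simp [h]

/-- Supports are monotone for the Loewner order. -/
theorem supp_mono {A B : Matrix n n ℂ} (hA : A.PosSemidef) (hB : B.PosSemidef)
    (hAB : (B - A).PosSemidef) : supp A ≤ supp B := by
  refine supp_le_supp_of_ker hA.1 hB.1 fun x hx => ?_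
  rw [← inner_eq_zero_iff hA]
  refine le_antisymm ?_ (inner_nonneg_of_posSemidef hA x)
  have h := inner_nonneg_of_posSemidef hAB x
  simpa [map_sub, LinearMap.sub_apply, hx] using h

theorem supp_zero : supp (0 : Matrix n n ℂ) = ⊥ := by
  rw [supp_eq_range Matrix.isHermitian_zero, map_zero, LinearMap.range_zero]

theorem supp_eq_bot_iff {A : Matrix n n ℂ} (hA : A.IsHermitian) : supp A = ⊥ ↔ A = 0 := by
  rw [supp_eq_range hA, LinearMap.range_eq_bot, map_eq_zero_iff _ Matrix.toEuclideanLin.injective]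

theorem supp_add_le {A B : Matrix n n ℂ} (hA : A.IsHermitian) (hB : B.IsHermitian) :
    supp (A + B) ≤ supp A ⊔ supp B := by
  rw [supp_eq_range hA, supp_eq_range hB]
  refine (supp_le_range _).trans ?_
  rintro _ ⟨x, rfl⟩
  rw [map_add, LinearMap.add_apply]
  exact Submodule.add_mem_sup ⟨x, rfl⟩ ⟨x, rfl⟩

theorem supp_add {A B : Matrix n n ℂ} (hA : A.PosSemidef) (hB : B.PosSemidef) :
    supp (A + B) = supp A ⊔ supp B :=
  le_antisymm (supp_add_le hA.1 hB.1) (sup_le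
    (supp_mono hA (hA.add hB) (by simpa using hB)) (supp_mono hB (hA.add hB) (by simpa using hA)))

theorem supp_sum {κ : Type*} (t : Finset κ) (A : κ → Matrix n n ℂ) (hA : ∀ k, (A k).PosSemidef) :
    supp (∑ k ∈ t, A k) = t.sup fun k => supp (A k) := by
  classical
  induction t using Finset.induction_on with
  | empty => simp [supp_zero]
  | insert k t hk ih =>
    rw [Finset.sum_insert hk, Finset.sup_insert,
      supp_add (hA k) (Matrix.posSemidef_sum _ fun i _ => hA i), ih]

theorem supp_smul_le (c : ℝ) (A : Matrix n n ℂ) :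
    supp (c • A) ≤ LinearMap.range (Matrix.toEuclideanLin A) := by
  refine (supp_le_range _).trans ?_
  rintro _ ⟨x, rfl⟩
  rw [← Complex.coe_smul, map_smul]
  exact Submodule.smul_mem _ _ ⟨x, rfl⟩

/-- Every pure state in the support of a positive operator is dominated by a multiple of it. -/
theorem exists_smul_sub_ketbra_posSemidef {A : Matrix n n ℂ} (hA : A.PosSemidef)
    {ψ : EuclideanSpace ℂ n} (hψ : ψ ∈ supp A) :
    ∃ c : ℝ, 0 ≤ c ∧ (c • A - ketbra ψ).PosSemidef := by
  rw [supp_eq_range hA.1] at hψ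
  obtain ⟨φ, rfl⟩ := hψ
  obtain ⟨B, hB⟩ : ∃ B : Matrix n n ℂ, A = B.conjTranspose * B := by
    open scoped MatrixOrder in
    exact CStarAlgebra.nonneg_iff_eq_star_mul_self.mp hA.nonneg
  have key : ∀ x y : EuclideanSpace ℂ n, inner ℂ x (Matrix.toEuclideanLin A y)
      = inner ℂ (Matrix.toEuclideanLin B x) (Matrix.toEuclideanLin B y) := by
    intro x y
    rw [hB, toEuclideanLin_mul_apply, Matrix.toEuclideanLin_conjTranspose_eq_adjoint,
      LinearMap.adjoint_inner_right]
  -- With `A = B* B` and `ψ = A φ`, Cauchy–Schwarz gives `|⟨x, A φ⟩|² = |⟨B x, B φ⟩|² ≤ ‖B φ‖² ⟨x, A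
  -- x⟩`, whence the constant.
  refine ⟨‖Matrix.toEuclideanLin B φ‖ ^ 2, by positivity,
    posSemidef_of_inner_nonneg ?_ fun x => ?_⟩
  · refine Matrix.IsHermitian.sub ?_ (posSemidef_ketbra _).1
    rw [← Complex.coe_smul]
    exact (hA.smul (Complex.zero_le_real.mpr (sq_nonneg _))).1
  · rw [map_sub, ← Complex.coe_smul, map_smul, LinearMap.sub_apply, LinearMap.smul_apply,
      toEuclideanLin_ketbra, inner_sub_right, inner_smul_right, inner_smul_right,
      ← inner_conj_symm _ x, RCLike.conj_mul, key, key, inner_self_eq_norm_sq_to_K]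
    have h := norm_inner_le_norm (𝕜 := ℂ) (Matrix.toEuclideanLin B x) (Matrix.toEuclideanLin B φ)
    have h2 : ‖inner ℂ (Matrix.toEuclideanLin B x) (Matrix.toEuclideanLin B φ)‖ ^ 2
        ≤ ‖Matrix.toEuclideanLin B φ‖ ^ 2 * ‖Matrix.toEuclideanLin B x‖ ^ 2 := by
      rw [← mul_pow, mul_comm]
      exact pow_le_pow_left₀ (norm_nonneg _) h 2
    rw [Complex.sub_re, sub_nonneg]
    change (((‖inner ℂ (Matrix.toEuclideanLin B x) (Matrix.toEuclideanLin B φ)‖ : ℝ) : ℂ) ^ 2).re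
      ≤ (((‖Matrix.toEuclideanLin B φ‖ ^ 2 : ℝ) : ℂ) *
        ((‖Matrix.toEuclideanLin B x‖ : ℝ) : ℂ) ^ 2).re
    rw [← Complex.ofReal_pow, ← Complex.ofReal_pow, Complex.ofReal_re, Complex.re_ofReal_mul,
      Complex.ofReal_re]
    exact h2

/-- The functional calculus of a Hermitian matrix: `f` applied to the eigenvalues. -/
def spectralFun {A : Matrix n n ℂ} (hA : A.IsHermitian) (f : ℝ → ℝ) : Matrix n n ℂ :=
  Unitary.conjStarAlgAut ℂ _ hA.eigenvectorUnitary
    (Matrix.diagonal fun i => (f (hA.eigenvalues i) : ℂ))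

theorem spectralFun_id {A : Matrix n n ℂ} (hA : A.IsHermitian) : spectralFun hA id = A :=
  hA.spectral_theorem.symm

theorem spectralFun_mul {A : Matrix n n ℂ} (hA : A.IsHermitian) (f g : ℝ → ℝ) :
    spectralFun hA f * spectralFun hA g = spectralFun hA (f * g) := by
  rw [spectralFun, spectralFun, ← map_mul, Matrix.diagonal_mul_diagonal, spectralFun]
  simp only [Pi.mul_apply, Complex.ofReal_mul]

theorem spectralFun_sub {A : Matrix n n ℂ} (hA : A.IsHermitian) (f g : ℝ → ℝ) :
    spectralFun hA f - spectralFun hA g = spectralFun hA (f - g) := by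
  rw [spectralFun, spectralFun, ← map_sub, Matrix.diagonal_sub, spectralFun]
  simp only [Pi.sub_apply, Complex.ofReal_sub]

theorem posSemidef_spectralFun {A : Matrix n n ℂ} (hA : A.IsHermitian) {f : ℝ → ℝ}
    (hf : ∀ x, 0 ≤ f x) : (spectralFun hA f).PosSemidef := by
  rw [spectralFun, Unitary.conjStarAlgAut_apply]
  refine Matrix.PosSemidef.mul_mul_conjTranspose_same (Matrix.PosSemidef.diagonal fun i => ?_) _
  exact Complex.zero_le_real.mpr (hf _)

/-- The positive spectral projection of a Hermitian operator. -/
theorem exists_positive_projection {A : Matrix n n ℂ} (hA : A.IsHermitian) :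
    ∃ P : Matrix n n ℂ, P.IsHermitian ∧ P * P = P ∧ P * A = A * P ∧
      (P * A).PosSemidef ∧ (P * A - A).PosSemidef := by
  set f : ℝ → ℝ := fun x => if 0 < x then 1 else 0 with hf
  have hA' := spectralFun_id hA
  have hPA : spectralFun hA f * A = spectralFun hA (f * id) := by
    rw [← spectralFun_mul, hA']
  have hAP : A * spectralFun hA f = spectralFun hA (f * id) := by
    rw [mul_comm f, ← spectralFun_mul, hA']
  refine ⟨spectralFun hA f, (posSemidef_spectralFun hA fun x => ?_).1, ?_, hPA.trans hAP.symm,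
    ?_, ?_⟩
  · simp only [hf]; split_ifs <;> norm_num
  · rw [spectralFun_mul]
    congr 1
    ext x
    simp [hf]
  · rw [hPA]
    refine posSemidef_spectralFun hA fun x => ?_
    simp only [hf, Pi.mul_apply, id]
    split_ifs with h
    · simpa using h.le
    · simp
  · have h : spectralFun hA f * A - A = spectralFun hA (f * id - id) := by
      rw [← spectralFun_sub, ← hPA, hA']
    rw [h]
    refine posSemidef_spectralFun hA fun x => ?_
    simp only [hf, Pi.mul_apply, Pi.sub_apply, id]
    split_ifs with h <;> simp
    exact not_lt.mp h

/-- The orthogonal projection onto the support of a Hermitian operator. -/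
theorem exists_supp_projection {A : Matrix n n ℂ} (hA : A.IsHermitian) :
    ∃ P : Matrix n n ℂ, P.IsHermitian ∧ P * P = P ∧ supp P = supp A := by
  set f : ℝ → ℝ := fun x => if x = 0 then 0 else 1 with hf
  have hA' := spectralFun_id hA
  have hP : (spectralFun hA f).IsHermitian := by
    refine (posSemidef_spectralFun hA fun x => ?_).1
    simp only [hf]; split_ifs <;> norm_num
  refine ⟨spectralFun hA f, hP, ?_, le_antisymm ?_ ?_⟩
  · rw [spectralFun_mul]
    congr 1
    ext x
    simp [hf]
  · refine supp_le_supp_of_ker hP hA fun x hx => ?_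
    -- The convention `0⁻¹ = 0` makes `x⁻¹ * x` equal to the indicator of `x ≠ 0`, with no exception
    -- at zero.
    have h : spectralFun hA f = spectralFun hA (·⁻¹) * A := by
      have h1 : spectralFun hA (·⁻¹) * spectralFun hA id = spectralFun hA f := by
        rw [spectralFun_mul]
        congr 1
        ext x
        by_cases h : x = 0 <;> simp [hf, h]
      rw [hA'] at h1
      exact h1.symm
    rw [h, toEuclideanLin_mul_apply, hx, map_zero]
  · refine supp_le_supp_of_ker hA hP fun x hx => ?_
    have h : A = A * spectralFun hA f := by
      have h1 : spectralFun hA id * spectralFun hA f = spectralFun hA id := by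
        rw [spectralFun_mul]
        congr 1
        ext x
        by_cases h : x = 0 <;> simp [hf, h]
      rw [hA'] at h1
      exact h1.symm
    rw [h, toEuclideanLin_mul_apply, hx, map_zero]

end LinearAlgebra

/-! ### Positive maps, invariant subspaces and positive fixed points -/

section Positive

variable {n : Type*} [Fintype n] [DecidableEq n]

theorem posSemidef_real_smul {A : Matrix n n ℂ} (hA : A.PosSemidef) {c : ℝ} (hc : 0 ≤ c) :
    (c • A).PosSemidef := by
  rw [← Complex.coe_smul]
  exact hA.smul (Complex.zero_le_real.mpr hc)

theorem trace_re_nonneg {A : Matrix n n ℂ} (hA : A.PosSemidef) : 0 ≤ A.trace.re :=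
  (Complex.nonneg_iff.mp hA.trace_nonneg).1

theorem eq_zero_of_trace_re_nonpos {A : Matrix n n ℂ} (hA : A.PosSemidef)
    (h : A.trace.re ≤ 0) : A = 0 := by
  rw [← hA.trace_eq_zero_iff]
  have h1 := Complex.nonneg_iff.mp hA.trace_nonneg
  exact Complex.ext (le_antisymm h h1.1) h1.2.symm

theorem posSemidef_conj {A P : Matrix n n ℂ} (hA : A.PosSemidef) (hP : P.IsHermitian) :
    (P * A * P).PosSemidef := by
  have h := hA.mul_mul_conjTranspose_same P
  rwa [hP.eq] at h

/-- The form of `A` vanishes at every `P x`, so positivity gives `A P = 0`; taking adjoints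
exchanges the factors. This turns the vanishing of a diagonal block into the vanishing of its
off-diagonal neighbours. -/
theorem mul_eq_zero_of_conj_eq_zero {A P : Matrix n n ℂ} (hA : A.PosSemidef) (hP : P.IsHermitian)
    (h : P * A * P = 0) : P * A = 0 := by
  have h1 : A * P = 0 := by
    apply Matrix.toEuclideanLin.injective
    ext1 x
    rw [toEuclideanLin_mul_apply, map_zero, LinearMap.zero_apply, ← inner_eq_zero_iff hA,
      isSymmetric_of_isHermitian hP, ← toEuclideanLin_mul_apply, ← toEuclideanLin_mul_apply, h]
    simp
  have h2 := congrArg Matrix.conjTranspose h1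
  rwa [Matrix.conjTranspose_mul, hA.1.eq, hP.eq, Matrix.conjTranspose_zero] at h2

theorem isHermitian_one_sub {P : Matrix n n ℂ} (hP : P.IsHermitian) : (1 - P).IsHermitian :=
  Matrix.isHermitian_one.sub hP

theorem one_sub_mul_self {P : Matrix n n ℂ} (hPP : P * P = P) : (1 - P) * (1 - P) = 1 - P := by
  rw [sub_mul, mul_sub P, hPP]; simp

theorem trace_conj {P : Matrix n n ℂ} (hPP : P * P = P) (A : Matrix n n ℂ) :
    (P * A * P).trace = (P * A).trace := by
  rw [Matrix.trace_mul_comm, ← mul_assoc, hPP]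

theorem trace_eq_add_conj {P : Matrix n n ℂ} (hPP : P * P = P) (A : Matrix n n ℂ) :
    A.trace.re = (P * A * P).trace.re + ((1 - P) * A * (1 - P)).trace.re := by
  rw [trace_conj hPP, trace_conj (one_sub_mul_self hPP), ← Complex.add_re, ← Matrix.trace_add,
    ← add_mul, add_sub_cancel, one_mul]

theorem mem_supp_projection {P : Matrix n n ℂ} (hP : P.IsHermitian) (hPP : P * P = P)
    {x : EuclideanSpace ℂ n} : x ∈ supp P ↔ Matrix.toEuclideanLin P x = x := by
  rw [supp_eq_range hP]
  constructor
  · rintro ⟨y, rfl⟩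
    rw [← toEuclideanLin_mul_apply, hPP]
  · exact fun h => ⟨x, h⟩

theorem projection_mul_eq_self {P A : Matrix n n ℂ} (hP : P.IsHermitian) (hPP : P * P = P)
    (hA : A.IsHermitian) (h : supp A ≤ supp P) : P * A = A := by
  apply Matrix.toEuclideanLin.injective
  ext1 x
  rw [toEuclideanLin_mul_apply]
  refine (mem_supp_projection hP hPP).mp (h ?_)
  rw [supp_eq_range hA]
  exact ⟨x, rfl⟩

theorem supp_sub_le {A B : Matrix n n ℂ} (hA : A.IsHermitian) (hB : B.IsHermitian) :
    supp (A - B) ≤ supp A ⊔ supp B := by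
  rw [supp_eq_range hA, supp_eq_range hB]
  refine (supp_le_range _).trans ?_
  rintro _ ⟨x, rfl⟩
  rw [map_sub, LinearMap.sub_apply]
  exact sub_mem (Submodule.mem_sup_left ⟨x, rfl⟩) (Submodule.mem_sup_right ⟨x, rfl⟩)

theorem supp_ketbra_le {ψ : EuclideanSpace ℂ n} {R : Submodule ℂ (EuclideanSpace ℂ n)}
    (h : ψ ∈ R) : supp (ketbra ψ) ≤ R := by
  refine (supp_le_range _).trans ?_
  rintro _ ⟨x, rfl⟩
  rw [toEuclideanLin_ketbra]
  exact R.smul_mem _ h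

theorem mem_supp_ketbra (ψ : EuclideanSpace ℂ n) : ψ ∈ supp (ketbra ψ) := by
  by_cases h : ψ = 0
  · rw [h]; exact zero_mem _
  · refine Submodule.subset_span ⟨inner ℂ ψ ψ, ?_, toEuclideanLin_ketbra ψ ψ⟩
    simpa using h

/-- The real span of the pure states in a subspace. -/
def pureSpan (R : Submodule ℂ (EuclideanSpace ℂ n)) : Submodule ℝ (Matrix n n ℂ) :=
  Submodule.span ℝ (ketbra '' (R : Set (EuclideanSpace ℂ n)))

/-- By the spectral theorem. It lets properties of pure states extend to Hermitian operators by real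
linearity. -/
theorem mem_pureSpan_iff {R : Submodule ℂ (EuclideanSpace ℂ n)} {A : Matrix n n ℂ} :
    A ∈ pureSpan R ↔ A.IsHermitian ∧ supp A ≤ R := by
  constructor
  · intro h
    induction h using Submodule.span_induction with
    | mem x hx =>
      obtain ⟨ψ, hψ, rfl⟩ := hx
      exact ⟨(posSemidef_ketbra ψ).1, supp_ketbra_le hψ⟩
    | zero => exact ⟨Matrix.isHermitian_zero, by simp [supp_zero]⟩
    | add x y _ _ hx hy =>
      exact ⟨hx.1.add hy.1, (supp_add_le hx.1 hy.1).trans (sup_le hx.2 hy.2)⟩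
    | smul c x _ hx =>
      refine ⟨?_, (supp_smul_le c x).trans ((supp_eq_range hx.1).symm.le.trans hx.2)⟩
      rw [Matrix.IsHermitian, Matrix.conjTranspose_smul, hx.1.eq, star_trivial]
  · rintro ⟨hA, h⟩
    rw [eq_sum_ketbra hA]
    refine Submodule.sum_mem _ fun i _ => ?_
    by_cases hi : hA.eigenvalues i = 0
    · simp [hi]
    · exact Submodule.smul_mem _ _
        (Submodule.subset_span ⟨_, h (eigenvectorBasis_mem_supp hA hi), rfl⟩)

/-- Positive trace-nonincreasing super-operators. -/
structure IsSubstochastic (F : SuperOp n) : Prop where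
  posSemidef : ∀ X : Matrix n n ℂ, X.PosSemidef → (F X).PosSemidef
  trace_le : ∀ X : Matrix n n ℂ, X.PosSemidef → (F X).trace.re ≤ X.trace.re

/-- Supports of positive solutions of the stationary equation. -/
def IsStationarySupport (F : SuperOp n) (V : Submodule ℂ (EuclideanSpace ℂ n)) : Prop :=
  ∃ ρ : Matrix n n ℂ, ρ.PosSemidef ∧ F ρ = ρ ∧ supp ρ = V

theorem map_real_smul (F : SuperOp n) (c : ℝ) (A : Matrix n n ℂ) : F (c • A) = c • F A := by
  rw [← Complex.coe_smul, map_smul, Complex.coe_smul]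

theorem trace_re_real_smul (c : ℝ) (A : Matrix n n ℂ) : (c • A).trace.re = c * A.trace.re := by
  rw [Matrix.trace_smul, Complex.smul_re, smul_eq_mul]

theorem ketbra_eq_smul_unit {ψ : EuclideanSpace ℂ n} (hψ : ψ ≠ 0) :
    ‖((‖ψ‖⁻¹ : ℝ) : ℂ) • ψ‖ = 1 ∧
      ketbra ψ = (‖ψ‖ ^ 2) • ketbra (((‖ψ‖⁻¹ : ℝ) : ℂ) • ψ) := by
  have h : ‖ψ‖ ≠ 0 := norm_ne_zero_iff.mpr hψ
  refine ⟨?_, ?_⟩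
  · rw [norm_smul, Complex.norm_real, norm_inv, norm_norm, inv_mul_cancel₀ h]
  · rw [ketbra_smul, smul_smul, Complex.norm_real, norm_inv, norm_norm, inv_pow,
      mul_inv_cancel₀ (pow_ne_zero 2 h), one_smul]

theorem ketbra_zero : ketbra (0 : EuclideanSpace ℂ n) = 0 := by
  ext i j; simp [ketbra]

variable {F : SuperOp n}

theorem IsBottom.map_mem_pureSpan {R : Submodule ℂ (EuclideanSpace ℂ n)} (hF : IsSubstochastic F)
    (hR : IsBottom F R) {A : Matrix n n ℂ} (hA : A ∈ pureSpan R) : F A ∈ pureSpan R := by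
  induction hA using Submodule.span_induction with
  | mem x hx =>
    obtain ⟨ψ, hψ, rfl⟩ := hx
    by_cases h : ψ = 0
    · rw [h, ketbra_zero, map_zero]; exact zero_mem _
    · obtain ⟨h1, h2⟩ := ketbra_eq_smul_unit h
      rw [h2, map_real_smul]
      refine Submodule.smul_mem _ _ (mem_pureSpan_iff.mpr
        ⟨(hF.posSemidef _ (posSemidef_ketbra _)).1, hR _ (R.smul_mem _ hψ) h1⟩)
  | zero => rw [map_zero]; exact zero_mem _
  | add x y _ _ hx hy => rw [map_add]; exact add_mem hx hy
  | smul c x _ hx => rw [map_real_smul]; exact Submodule.smul_mem _ _ hx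

theorem IsBottom.supp_map_le {R : Submodule ℂ (EuclideanSpace ℂ n)} (hF : IsSubstochastic F)
    (hR : IsBottom F R) {A : Matrix n n ℂ} (hA : A.IsHermitian) (h : supp A ≤ R) :
    supp (F A) ≤ R :=
  (mem_pureSpan_iff.mp (hR.map_mem_pureSpan hF (mem_pureSpan_iff.mpr ⟨hA, h⟩))).2

/-- Each pure state in the support is dominated by a multiple of `A`; positivity of `F` transports
the domination to the images, and supports are monotone. -/
theorem isBottom_supp (hF : IsSubstochastic F) {A : Matrix n n ℂ} (hA : A.PosSemidef)
    (h : supp (F A) ≤ supp A) : IsBottom F (supp A) := by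
  intro ψ hψ _
  obtain ⟨c, hc, hcA⟩ := exists_smul_sub_ketbra_posSemidef hA hψ
  have h1 := hF.posSemidef _ hcA
  rw [map_sub, map_real_smul] at h1
  have hFA := hF.posSemidef _ hA
  refine (supp_mono (hF.posSemidef _ (posSemidef_ketbra _))
    (posSemidef_real_smul hFA hc) h1).trans ?_
  exact (supp_smul_le c (F A)).trans ((supp_eq_range hFA.1).symm.le.trans h)

theorem IsStationarySupport.isBottom (hF : IsSubstochastic F)
    {V : Submodule ℂ (EuclideanSpace ℂ n)} (hV : IsStationarySupport F V) : IsBottom F V := by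
  obtain ⟨ρ, hρ, hfix, rfl⟩ := hV
  exact isBottom_supp hF hρ (by rw [hfix])

/-- The trace lost is nonnegative on positive operators and zero on the fixed point. A pure state
dominated by a multiple of the fixed point therefore loses none. -/
theorem IsStationarySupport.trace_map_ketbra (hF : IsSubstochastic F)
    {V : Submodule ℂ (EuclideanSpace ℂ n)} (hV : IsStationarySupport F V)
    {ψ : EuclideanSpace ℂ n} (hψ : ψ ∈ V) : (F (ketbra ψ)).trace.re = (ketbra ψ).trace.re := by
  obtain ⟨ρ, hρ, hfix, rfl⟩ := hV
  obtain ⟨c, hc, hcA⟩ := exists_smul_sub_ketbra_posSemidef hρ hψ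
  have h1 := hF.trace_le _ hcA
  rw [map_sub, map_real_smul, hfix, Matrix.trace_sub, Matrix.trace_sub, Complex.sub_re,
    Complex.sub_re] at h1
  exact le_antisymm (hF.trace_le _ (posSemidef_ketbra ψ)) (by linarith)

theorem isStationarySupport_bot : IsStationarySupport F ⊥ :=
  ⟨0, Matrix.PosSemidef.zero, map_zero F, supp_zero⟩

theorem IsStationarySupport.sup {V W : Submodule ℂ (EuclideanSpace ℂ n)}
    (hV : IsStationarySupport F V) (hW : IsStationarySupport F W) :
    IsStationarySupport F (V ⊔ W) := by
  obtain ⟨ρ, hρ, hρF, rfl⟩ := hV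
  obtain ⟨σ, hσ, hσF, rfl⟩ := hW
  exact ⟨ρ + σ, hρ.add hσ, by rw [map_add, hρF, hσF], supp_add hρ hσ⟩

/-- Finite dimension reduces the supremum to a finite one, which the sum of the corresponding fixed
points realizes. -/
theorem isStationarySupport_sSup {𝓑 : Set (Submodule ℂ (EuclideanSpace ℂ n))}
    (h : ∀ B ∈ 𝓑, IsStationarySupport F B) : IsStationarySupport F (sSup 𝓑) := by
  obtain ⟨t, ht, hs⟩ := (CompleteLattice.wellFoundedGT_iff_isSupFiniteCompact
    (Submodule ℂ (EuclideanSpace ℂ n))).mp inferInstance 𝓑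
  rw [hs]
  exact Finset.sup_induction isStationarySupport_bot (fun _ h₁ _ h₂ => h₁.sup h₂)
    fun B hB => h B (ht hB)

/-- A Hermitian solution of the stationary equation is a difference of positive solutions. -/
theorem exists_fixed_posSemidef_sub (hF : IsSubstochastic F) {γ : Matrix n n ℂ}
    (hγ : γ.IsHermitian) (hfix : F γ = γ) :
    ∃ A B : Matrix n n ℂ, A.PosSemidef ∧ B.PosSemidef ∧ F A = A ∧ F B = B ∧ γ = A - B ∧
      supp A ≤ supp γ ∧ supp B ≤ supp γ := by
  obtain ⟨P, hP, hPP, hcomm, hA, hB⟩ := exists_positive_projection hγ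
  have hFA := hF.posSemidef _ hA
  have hFB := hF.posSemidef _ hB
  have hsub : F (P * γ) - F (P * γ - γ) = γ := by rw [map_sub, hfix, sub_sub_cancel]
  have hQ := isHermitian_one_sub hP
  -- Let `A = P γ`, `B = P γ - γ`, `Q = 1 - P`. Since `F A - F B = γ`, comparing `tr A = tr (P F(A)
  -- P) - tr (P F(B) P)` with `tr F(A) ≤ tr A` gives `tr (Q F(A) Q) + tr (P F(B) P) ≤ 0`. Both terms
  -- are nonnegative, so `Q F(A) = 0` and `P F(B) = 0`.
  have htr : (P * γ).trace.re
      = (P * F (P * γ) * P).trace.re - (P * F (P * γ - γ) * P).trace.re := by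
    rw [trace_conj hPP, trace_conj hPP, ← Complex.sub_re, ← Matrix.trace_sub, ← mul_sub, hsub]
  have h1 := trace_eq_add_conj hPP (F (P * γ))
  have h2 := hF.trace_le _ hA
  have h3 := trace_re_nonneg (posSemidef_conj hFA hQ)
  have h4 := trace_re_nonneg (posSemidef_conj hFB hP)
  have h5 := mul_eq_zero_of_conj_eq_zero hFA hQ
    (eq_zero_of_trace_re_nonpos (posSemidef_conj hFA hQ) (by linarith))
  have h6 := mul_eq_zero_of_conj_eq_zero hFB hP
    (eq_zero_of_trace_re_nonpos (posSemidef_conj hFB hP) (by linarith))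
  have hfixA : F (P * γ) = P * γ := by
    rw [sub_mul, one_mul, sub_eq_zero] at h5
    have h7 := congrArg (P * ·) hsub
    simp only [mul_sub, h6, sub_zero] at h7
    rw [h5]
    simpa using h7
  refine ⟨P * γ, P * γ - γ, hA, hB, hfixA, by rw [map_sub, hfixA, hfix], (sub_sub_cancel _ _).symm,
    supp_le_supp_of_ker hA.1 hγ fun x hx => ?_, supp_le_supp_of_ker hB.1 hγ fun x hx => ?_⟩
  · rw [toEuclideanLin_mul_apply, hx, map_zero]
  · rw [map_sub, LinearMap.sub_apply, toEuclideanLin_mul_apply, hx, map_zero, sub_zero]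

/-- A nonzero invariant subspace on which the trace is preserved carries a stationary state. -/
theorem IsBottom.exists_isStationarySupport (hF : IsSubstochastic F)
    {R : Submodule ℂ (EuclideanSpace ℂ n)} (hR : IsBottom F R) (hne : R ≠ ⊥)
    (htr : ∀ ψ ∈ R, (F (ketbra ψ)).trace.re = (ketbra ψ).trace.re) :
    ∃ V ≤ R, V ≠ ⊥ ∧ IsStationarySupport F V := by
  obtain ⟨X, hX, hX0, hfix⟩ : ∃ X ∈ pureSpan R, X ≠ 0 ∧ F X = X := by
    let T : pureSpan R →ₗ[ℝ] pureSpan R :=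
      LinearMap.restrict (F.restrictScalars ℝ : Matrix n n ℂ →ₗ[ℝ] Matrix n n ℂ)
        fun A hA => hR.map_mem_pureSpan hF hA
    let τ : Matrix n n ℂ →ₗ[ℝ] ℝ :=
      Complex.reLm ∘ₗ (Matrix.traceLinearMap n ℂ ℂ).restrictScalars ℝ
    have hτ : ∀ A ∈ pureSpan R, τ (F A) = τ A := by
      intro A hA
      induction hA using Submodule.span_induction with
      | mem x hx =>
        obtain ⟨ψ, hψ, rfl⟩ := hx
        exact htr ψ hψ
      | zero => rw [map_zero]
      | add x y _ _ hx hy => rw [map_add, map_add, map_add, hx, hy]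
      | smul c x _ hx => rw [map_real_smul, map_smul, map_smul, hx]
    -- Trace preservation puts the range of `T - id` among operators of trace zero, which misses a
    -- nonzero pure state. In finite dimension failure of surjectivity is failure of injectivity, so
    -- a nonzero fixed point exists.
    have hnotinj : ¬ Function.Injective (T - LinearMap.id (R := ℝ) (M := pureSpan R)) := by
      rw [LinearMap.injective_iff_surjective]
      intro hsurj
      obtain ⟨ψ, hψ, hψ0⟩ := Submodule.exists_mem_ne_zero_of_ne_bot hne
      obtain ⟨Y, hY⟩ := hsurj ⟨ketbra ψ, Submodule.subset_span ⟨ψ, hψ, rfl⟩⟩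
      have h1 : F Y - Y = ketbra ψ := congrArg Subtype.val hY
      have h2 : τ (F Y - Y) = 0 := by rw [map_sub, hτ Y Y.2, sub_self]
      rw [h1] at h2
      have h3 : ‖ψ‖ ^ 2 = 0 := (trace_ketbra ψ).symm.trans h2
      exact hψ0 (norm_eq_zero.mp (pow_eq_zero_iff two_ne_zero |>.mp h3))
    rw [← LinearMap.ker_eq_bot] at hnotinj
    obtain ⟨Y, hY, hY0⟩ := Submodule.exists_mem_ne_zero_of_ne_bot hnotinj
    refine ⟨Y, Y.2, fun h => hY0 (Subtype.ext h), ?_⟩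
    have h1 : F Y - Y = 0 := congrArg Subtype.val (LinearMap.mem_ker.mp hY)
    exact sub_eq_zero.mp h1
  obtain ⟨hXh, hXR⟩ := mem_pureSpan_iff.mp hX
  obtain ⟨A, B, hA, hB, hFA, hFB, hAB, hsA, hsB⟩ := exists_fixed_posSemidef_sub hF hXh hfix
  by_cases h : A = 0
  · refine ⟨supp B, hsB.trans hXR, fun hb => hX0 ?_, B, hB, hFB, rfl⟩
    rw [hAB, h, (supp_eq_bot_iff hB.1).mp hb, sub_zero]
  · exact ⟨supp A, hsA.trans hXR, fun ha => h ((supp_eq_bot_iff hA.1).mp ha), A, hA, hFA, rfl⟩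

theorem posSemidef_pow (hF : IsSubstochastic F) {X : Matrix n n ℂ} (hX : X.PosSemidef) (i : ℕ) :
    ((F ^ i) X).PosSemidef := by
  induction i with
  | zero => simpa using hX
  | succ i ih => rw [pow_succ', Module.End.mul_apply]; exact hF.posSemidef _ ih

theorem IsBottom.supp_pow_le {R : Submodule ℂ (EuclideanSpace ℂ n)} (hF : IsSubstochastic F)
    (hR : IsBottom F R) {A : Matrix n n ℂ} (hA : A.PosSemidef) (h : supp A ≤ R) (i : ℕ) :
    supp ((F ^ i) A) ≤ R := by
  induction i with
  | zero => simpa using h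
  | succ i ih =>
    rw [pow_succ', Module.End.mul_apply]
    exact hR.supp_map_le hF (posSemidef_pow hF hA i).1 ih

/-- By the Noetherian property finitely many iterates already give the whole reachable space, which
is then the support of a single positive operator, their sum. -/
theorem isBottom_iSup_supp_pow (hF : IsSubstochastic F) {X : Matrix n n ℂ} (hX : X.PosSemidef) :
    IsBottom F (⨆ i : ℕ, supp ((F ^ i) X)) := by
  obtain ⟨t, ht⟩ : ∃ t : Finset ℕ, ⨆ i : ℕ, supp ((F ^ i) X) = t.sup fun i => supp ((F ^ i) X) := by
    obtain ⟨t, ht⟩ := CompleteLattice.IsCompactElement.exists_finset_of_le_iSup _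
      ((Submodule.fg_iff_compact _).mp (IsNoetherian.noetherian (⨆ i : ℕ, supp ((F ^ i) X))))
      (fun i : ℕ => supp ((F ^ i) X)) le_rfl
    refine ⟨t, le_antisymm ?_ (Finset.sup_le fun i _ => le_iSup (fun i => supp ((F ^ i) X)) i)⟩
    rw [Finset.sup_eq_iSup]
    exact ht
  have hpos := posSemidef_pow hF hX
  rw [ht, ← supp_sum t _ hpos]
  refine isBottom_supp hF (Matrix.posSemidef_sum _ fun i _ => hpos i) ?_
  have h1 : F (∑ i ∈ t, (F ^ i) X) = ∑ i ∈ t, (F ^ (i + 1)) X := by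
    rw [map_sum]
    exact Finset.sum_congr rfl fun i _ => by rw [pow_succ', Module.End.mul_apply]
  rw [h1, supp_sum t _ fun i => hpos (i + 1), supp_sum t _ hpos, ← ht]
  exact Finset.sup_le fun i _ => le_iSup (fun i => supp ((F ^ i) X)) (i + 1)

/-- The space reachable from a vector of `V` is invariant and inherits trace preservation from `V`,
so it contains a nonzero stationary support, which minimality forces to be `V`. Trace preservation
also gives properness. -/
theorem isProperBSCC_of_minimal (hF : IsSubstochastic F) {V : Submodule ℂ (EuclideanSpace ℂ n)}
    (hV : IsStationarySupport F V) (hne : V ≠ ⊥)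
    (hmin : ∀ W ≤ V, W ≠ ⊥ → IsStationarySupport F W → V ≤ W) : IsProperBSCC F V := by
  have hbot := hV.isBottom hF
  refine ⟨⟨hbot, fun ψ₁ h₁ ψ₂ h₂ hn₁ _ => ?_⟩, ?_⟩
  · rw [← Submodule.iSup_eq_span]
    have hψ := posSemidef_ketbra ψ₁
    have hle : ⨆ i : ℕ, supp ((F ^ i) (ketbra ψ₁)) ≤ V :=
      iSup_le fun i => hbot.supp_pow_le hF hψ (supp_ketbra_le h₁) i
    have hmem : ψ₁ ∈ ⨆ i : ℕ, supp ((F ^ i) (ketbra ψ₁)) :=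
      Submodule.mem_iSup_of_mem 0 (by simpa using mem_supp_ketbra ψ₁)
    have hψ0 : ψ₁ ≠ 0 := by rintro rfl; simp at hn₁
    obtain ⟨W, hW, hW0, hWs⟩ := (isBottom_iSup_supp_pow hF hψ).exists_isStationarySupport hF
      (fun h => hψ0 (by rwa [h, Submodule.mem_bot] at hmem))
      fun ψ h => hV.trace_map_ketbra hF (hle h)
    exact hW (hmin W (hW.trans hle) hW0 hWs h₂)
  · obtain ⟨ψ, hψ, hψ0⟩ := Submodule.exists_mem_ne_zero_of_ne_bot hne
    have hn := (ketbra_eq_smul_unit hψ0).1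
    refine ⟨_, V.smul_mem _ hψ, hn, fun h => ?_⟩
    have h1 := hV.trace_map_ketbra hF (V.smul_mem ((‖ψ‖⁻¹ : ℝ) : ℂ) hψ)
    rw [h, trace_ketbra, hn] at h1
    simp at h1

theorem IsStationarySupport.exists_isProperBSCC_le (hF : IsSubstochastic F)
    {V : Submodule ℂ (EuclideanSpace ℂ n)} (hV : IsStationarySupport F V) (hne : V ≠ ⊥) :
    ∃ W ≤ V, IsStationarySupport F W ∧ IsProperBSCC F W := by
  obtain ⟨W, ⟨hW, hW0, hWV⟩, hmin⟩ := wellFounded_lt.has_min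
    {W : Submodule ℂ (EuclideanSpace ℂ n) | IsStationarySupport F W ∧ W ≠ ⊥ ∧ W ≤ V}
    ⟨V, hV, hne, le_rfl⟩
  refine ⟨W, hWV, hW, isProperBSCC_of_minimal hF hW hW0 fun U hU hU0 hUs => ?_⟩
  by_contra h
  exact hmin U ⟨hUs, hU0, hU.trans hWV⟩ (lt_of_le_not_ge hU h)

theorem IsProperBSCC.ne_bot {B : Submodule ℂ (EuclideanSpace ℂ n)} (hB : IsProperBSCC F B) :
    B ≠ ⊥ := by
  rintro rfl
  obtain ⟨-, ψ, hψ, hn, -⟩ := hB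
  rw [(Submodule.mem_bot ℂ).mp hψ] at hn
  simp at hn

/-- Relative orthogonal complements of stationary supports are stationary supports. -/
theorem IsStationarySupport.inf_orthogonal (hF : IsSubstochastic F)
    {U V : Submodule ℂ (EuclideanSpace ℂ n)} (hU : IsStationarySupport F U)
    (hV : IsStationarySupport F V) (hUV : U ≤ V) : IsStationarySupport F (Uᗮ ⊓ V) := by
  have hbot := hU.isBottom hF
  obtain ⟨σ, hσ, -, rfl⟩ := hU
  obtain ⟨ρ, hρ, hfix, rfl⟩ := hV
  obtain ⟨P, hP, hPP, hPs⟩ := exists_supp_projection hσ.1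
  rw [← hPs] at hUV hbot ⊢
  set Q := 1 - P with hQdef
  have hQ : Q.IsHermitian := isHermitian_one_sub hP
  have hQP : Q * P = 0 := by rw [hQdef, sub_mul, hPP, one_mul, sub_self]
  have hPQ0 : P * Q = 0 := by rw [hQdef, mul_sub, hPP, mul_one, sub_self]
  have hPsd := posSemidef_conj hρ hQ
  have hPQ : P + Q = 1 := add_sub_cancel P 1
  -- Invariance of `U`: the block of `ρ` on `U` is mapped to an operator supported in `U`.
  have hFP : Q * F (P * ρ * P) = 0 := by
    have h1 := posSemidef_conj hρ hP
    have h2 := projection_mul_eq_self hP hPP (hF.posSemidef _ h1).1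
      (hbot.supp_map_le hF h1.1 (supp_le_supp_of_ker h1.1 hP fun x hx => by
        rw [toEuclideanLin_mul_apply, hx, map_zero]))
    rw [← h2, ← mul_assoc, hQP, zero_mul]
  set C := P * ρ * Q + Q * ρ * P with hC
  -- Conjugating `ρ` by `a P + Q` scales the off-diagonal part `C` by `a` and the `P`-block by `a²`;
  -- the latter disappears after compression by `Q`. A form that is affine in `a` and nonnegative
  -- for all real `a` has zero slope, so `C` contributes nothing to the `Q`-block.
  have hexp : ∀ a : ℝ, (Q * F (Q * ρ * Q) * Q + a • (Q * F C * Q)).PosSemidef := by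
    intro a
    have hH : (a • P + Q).IsHermitian := by
      refine Matrix.IsHermitian.add ?_ hQ
      rw [Matrix.IsHermitian, Matrix.conjTranspose_smul, hP.eq, star_trivial]
    have h1 := posSemidef_conj (hF.posSemidef _ (posSemidef_conj hρ hH)) hQ
    have h2 : (a • P + Q) * ρ * (a • P + Q)
        = (a * a) • (P * ρ * P) + a • C + Q * ρ * Q := by
      simp only [hC, add_mul, mul_add, smul_mul_assoc, mul_smul_comm, smul_add, smul_smul]
      abel
    rw [h2, map_add, map_add, map_real_smul, map_real_smul, mul_add, mul_add, mul_smul_comm, hFP,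
      smul_zero, zero_add, add_mul, mul_smul_comm, smul_mul_assoc, add_comm] at h1
    exact h1
  have hQC : Q * F C * Q = 0 := by
    have hlin : ∀ x, (inner ℂ x (Matrix.toEuclideanLin (Q * F C * Q) x)).re = 0 := by
      intro x
      set b := (inner ℂ x (Matrix.toEuclideanLin (Q * F C * Q) x)).re with hb
      set d := (inner ℂ x (Matrix.toEuclideanLin (Q * F (Q * ρ * Q) * Q) x)).re with hd
      have h1 : ∀ a : ℝ, 0 ≤ d + a * b := by
        intro a
        have h2 := inner_nonneg_of_posSemidef (hexp a) x
        rw [← Complex.coe_smul, map_add, map_smul, LinearMap.add_apply, LinearMap.smul_apply,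
          inner_add_right, inner_smul_right, Complex.add_re, Complex.re_ofReal_mul] at h2
        exact h2
      by_contra hb0
      have h3 := h1 (-(d + 1) / b)
      rw [div_mul_cancel₀ _ hb0] at h3
      linarith
    have hH : (Q * F C * Q).IsHermitian := by
      have h1 := (hexp 1).1.sub (hexp 0).1
      simpa using h1
    have hz : (Q * F C * Q).PosSemidef := posSemidef_of_inner_nonneg hH fun x => (hlin x).ge
    apply Matrix.toEuclideanLin.injective
    ext1 x
    rw [map_zero, LinearMap.zero_apply]
    exact (inner_eq_zero_iff hz x).mp (hlin x)
  have hmain : Q * F (Q * ρ * Q) * Q = Q * ρ * Q := by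
    have h1 : ρ = P * ρ * P + C + Q * ρ * Q := by
      conv_lhs => rw [← one_mul ρ, ← mul_one (1 * ρ), ← hPQ]
      rw [hC]
      simp only [add_mul, mul_add]
      abel
    have h2 := congrArg (fun X => Q * F X * Q) h1
    simp only [map_add, mul_add, add_mul, hfix, hFP, hQC, zero_add] at h2
    exact h2.symm
  have hFpsd := hF.posSemidef _ hPsd
  -- The `Q`-block of the image already carries the full trace of `Q ρ Q`, so no trace is left for
  -- the `P`-block.
  have hzero : P * F (Q * ρ * Q) = 0 := by
    refine mul_eq_zero_of_conj_eq_zero hFpsd hP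
      (eq_zero_of_trace_re_nonpos (posSemidef_conj hFpsd hP) ?_)
    have h1 := trace_eq_add_conj hPP (F (Q * ρ * Q))
    rw [← hQdef, hmain] at h1
    have h2 := hF.trace_le _ hPsd
    linarith
  have hfix' : F (Q * ρ * Q) = Q * ρ * Q := by
    have h1 : Q * F (Q * ρ * Q) = F (Q * ρ * Q) := by rw [hQdef, sub_mul, hzero, one_mul, sub_zero]
    have h2 : F (Q * ρ * Q) * Q = F (Q * ρ * Q) := by
      have h3 := congrArg Matrix.conjTranspose h1
      rwa [Matrix.conjTranspose_mul, hFpsd.1.eq, hQ.eq] at h3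
    rwa [h1, h2] at hmain
  refine ⟨Q * ρ * Q, hPsd, hfix', ?_⟩
  have hQx : ∀ x, Matrix.toEuclideanLin Q x = x - Matrix.toEuclideanLin P x := fun x => by
    rw [hQdef, map_sub, LinearMap.sub_apply, Matrix.toLpLin_one, LinearMap.id_apply]
  have hle : supp (Q * ρ * Q) ≤ (supp P)ᗮ ⊓ supp ρ := by
    refine (supp_le_range _).trans ?_
    rintro _ ⟨x, rfl⟩
    refine ⟨(orthogonal_supp hP).mpr ?_, ?_⟩
    · rw [← toEuclideanLin_mul_apply, ← mul_assoc, ← mul_assoc, hPQ0]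
      simp
    · rw [mul_assoc, toEuclideanLin_mul_apply, hQx, toEuclideanLin_mul_apply]
      refine sub_mem ?_ (hUV ?_)
      · rw [supp_eq_range hρ.1]; exact ⟨_, rfl⟩
      · rw [supp_eq_range hP]; exact ⟨_, rfl⟩
  -- For equality, a vector of `Uᗮ ⊓ V` orthogonal to the support of `Q ρ Q` must vanish: it is
  -- fixed by `Q`, hence killed by `ρ`, hence orthogonal to `V`.
  rw [← Submodule.sup_orthogonal_inf_of_hasOrthogonalProjection hle, left_eq_sup]
  rintro x ⟨hx, hxP, hxρ⟩
  have h1 : Matrix.toEuclideanLin Q x = x := by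
    rw [hQx, (orthogonal_supp hP).mp hxP, sub_zero]
  have h2 : Matrix.toEuclideanLin ρ x = 0 := by
    have h3 := (orthogonal_supp hPsd.1).mp hx
    rw [← inner_eq_zero_iff hρ]
    conv_lhs => rw [← h1]
    rw [isSymmetric_of_isHermitian hQ, ← toEuclideanLin_mul_apply, ← toEuclideanLin_mul_apply,
      h3]
    simp
  have h4 : x = 0 := by
    rw [← Submodule.mem_bot ℂ, ← (supp ρ).inf_orthogonal_eq_bot]
    exact ⟨hxρ, (orthogonal_supp hρ.1).mpr h2⟩
  rw [h4]
  exact zero_mem _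

end Positive

/-! ### Proper BSCC subspaces and orthogonal decompositions -/

section Decomposition

variable {n : Type*} [Fintype n] [DecidableEq n] {F : SuperOp n}

/-- A killed vector reaches only its own line. Strong connectedness would make the subspace that
line, and all of it would be annihilated. -/
theorem IsProperBSCC.map_ketbra_ne_zero {B : Submodule ℂ (EuclideanSpace ℂ n)}
    (hB : IsProperBSCC F B) {φ : EuclideanSpace ℂ n} (hφ : φ ∈ B) (hφ0 : φ ≠ 0) :
    F (ketbra φ) ≠ 0 := by
  intro h
  obtain ⟨⟨-, hscc⟩, ψ, hψ, hn, hne⟩ := hB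
  obtain ⟨h1, h2⟩ := ketbra_eq_smul_unit hφ0
  set χ := ((‖φ‖⁻¹ : ℝ) : ℂ) • φ with hχ
  have hFχ : F (ketbra χ) = 0 := by
    rw [hχ, ketbra_smul, map_real_smul, h, smul_zero]
  have hmem := hscc χ (B.smul_mem _ hφ) ψ hψ h1 hn
  rw [← Submodule.iSup_eq_span] at hmem
  have hle : ⨆ i : ℕ, supp ((F ^ i) (ketbra χ)) ≤ Submodule.span ℂ {χ} := by
    refine iSup_le fun i => ?_
    cases i with
    | zero => simpa using supp_ketbra_le (Submodule.mem_span_singleton_self χ)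
    | succ i => rw [pow_succ, Module.End.mul_apply, hFχ, map_zero, supp_zero]; exact bot_le
  obtain ⟨c, rfl⟩ := Submodule.mem_span_singleton.mp (hle hmem)
  exact hne (by rw [ketbra_smul, map_real_smul, hFχ, smul_zero])

/-- A proper BSCC subspace is the support of a stationary state, provided that the lost trace is
lost by pure states that are killed altogether. -/
theorem IsProperBSCC.isStationarySupport (hF : IsSubstochastic F) {P : Matrix n n ℂ}
    (hPP : P * P = P) (hcomm : ∀ X, P * F X = F X * P)
    (hkill : ∀ φ, Matrix.toEuclideanLin P φ = 0 → F (ketbra φ) = 0)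
    (htr : ∀ φ, Matrix.toEuclideanLin P φ = φ → (F (ketbra φ)).trace.re = (ketbra φ).trace.re)
    {B : Submodule ℂ (EuclideanSpace ℂ n)} (hB : IsProperBSCC F B) :
    IsStationarySupport F B := by
  have hbot := hB.1.1
  -- Commutation makes `supp (F X)` stable under `P`, so `φ - P φ` lies in `B`. It is killed by `P`,
  -- hence its pure state by `F`, and a proper BSCC subspace has no such nonzero vector.
  have hmap : ∀ X : Matrix n n ℂ, X.PosSemidef → supp X ≤ B → ∀ φ ∈ supp (F X),
      Matrix.toEuclideanLin P φ = φ := by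
    intro X hX hXB φ hφ
    have hFX := hF.posSemidef X hX
    have hPφ : Matrix.toEuclideanLin P φ ∈ supp (F X) := by
      rw [supp_eq_range hFX.1] at hφ ⊢
      obtain ⟨y, rfl⟩ := hφ
      exact ⟨Matrix.toEuclideanLin P y, by
        rw [← toEuclideanLin_mul_apply, ← toEuclideanLin_mul_apply, hcomm]⟩
    have hmem : φ - Matrix.toEuclideanLin P φ ∈ B :=
      hbot.supp_map_le hF hX.1 hXB (sub_mem hφ hPφ)
    by_contra hne
    refine hB.map_ketbra_ne_zero hmem (fun h => hne (sub_eq_zero.mp h).symm) (hkill _ ?_)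
    rw [map_sub, ← toEuclideanLin_mul_apply, hPP, sub_self]
  -- The reachable space includes the starting vector (`i = 0`), so the start is taken inside an
  -- image, where `hmap` applies; all of `B` is reachable from there.
  have hBP : ∀ φ ∈ B, Matrix.toEuclideanLin P φ = φ := by
    obtain ⟨ψ, hψ, hn, hne⟩ := hB.2
    have hψ' := posSemidef_ketbra ψ
    have hFψ := hF.posSemidef _ hψ'
    obtain ⟨χ, hχ, hχ0⟩ := Submodule.exists_mem_ne_zero_of_ne_bot
      (fun h => hne ((supp_eq_bot_iff hFψ.1).mp h))
    have hχB := hbot.supp_map_le hF hψ'.1 (supp_ketbra_le hψ) hχ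
    have hχP := hmap _ hψ' (supp_ketbra_le hψ) χ hχ
    have hn' := (ketbra_eq_smul_unit hχ0).1
    set ω := ((‖χ‖⁻¹ : ℝ) : ℂ) • χ with hω
    have hωB : ω ∈ B := B.smul_mem _ hχB
    have hωP : Matrix.toEuclideanLin P ω = ω := by rw [hω, map_smul, hχP]
    have hker : ∀ φ, φ ∈ LinearMap.ker (Matrix.toEuclideanLin P - LinearMap.id) ↔
        Matrix.toEuclideanLin P φ = φ := fun φ => by
      rw [LinearMap.mem_ker, LinearMap.sub_apply, sub_eq_zero, LinearMap.id_apply]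
    have hle : ⨆ i : ℕ, supp ((F ^ i) (ketbra ω))
        ≤ LinearMap.ker (Matrix.toEuclideanLin P - LinearMap.id) := by
      refine iSup_le fun i => ?_
      cases i with
      | zero => simpa using supp_ketbra_le ((hker ω).mpr hωP)
      | succ i =>
        intro φ hφ
        rw [pow_succ', Module.End.mul_apply] at hφ
        exact (hker φ).mpr (hmap _ (posSemidef_pow hF (posSemidef_ketbra ω) i)
          (hbot.supp_pow_le hF (posSemidef_ketbra ω) (supp_ketbra_le hωB) i) φ hφ)
    intro φ hφ
    by_cases h0 : φ = 0
    · rw [h0, map_zero]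
    have h1 := hB.1.2 ω hωB _ (B.smul_mem _ hφ) hn' (ketbra_eq_smul_unit h0).1
    rw [← Submodule.iSup_eq_span] at h1
    rw [← hker]
    have hc : ((‖φ‖⁻¹ : ℝ) : ℂ) ≠ 0 := by simpa using h0
    exact (Submodule.smul_mem_iff _ hc).mp (hle h1)
  obtain ⟨V, hVB, hV0, hV⟩ := hbot.exists_isStationarySupport hF hB.ne_bot
    fun φ hφ => htr φ (hBP φ hφ)
  obtain ⟨χ, hχ, hχ0⟩ := Submodule.exists_mem_ne_zero_of_ne_bot hV0
  have hle : B ≤ V := by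
    intro φ hφ
    by_cases h0 : φ = 0
    · rw [h0]; exact zero_mem _
    have h1 := hB.1.2 _ (B.smul_mem _ (hVB hχ)) _ (B.smul_mem _ hφ) (ketbra_eq_smul_unit hχ0).1
      (ketbra_eq_smul_unit h0).1
    rw [← Submodule.iSup_eq_span] at h1
    have hc : ((‖φ‖⁻¹ : ℝ) : ℂ) ≠ 0 := by simpa using h0
    refine (Submodule.smul_mem_iff _ hc).mp ((iSup_le fun i => ?_ : _ ≤ V) h1)
    exact (hV.isBottom hF).supp_pow_le hF (posSemidef_ketbra _)
      (supp_ketbra_le (V.smul_mem _ hχ)) i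
  rwa [le_antisymm hle hVB]

theorem isStationarySupport_span_supp (hF : IsSubstochastic F) {m : ℕ}
    {γ : Fin m → Matrix n n ℂ} (hγ : IsSolutionBasis F γ) :
    IsStationarySupport F
        (Submodule.span ℂ (⋃ i : Fin m, (supp (γ i) : Set (EuclideanSpace ℂ n)))) ∧
      ∀ V, IsStationarySupport F V →
        V ≤ Submodule.span ℂ (⋃ i : Fin m, (supp (γ i) : Set (EuclideanSpace ℂ n))) := by
  rw [← Submodule.iSup_eq_span]
  have hle : ∀ V, IsStationarySupport F V → V ≤ ⨆ i, supp (γ i) := by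
    rintro _ ⟨ρ, hρ, hfix, rfl⟩
    -- A positive fixed point is a real combination of the `γ i`, so its support lies in the sum of
    -- theirs.
    have h1 : Submodule.span ℝ (Set.range γ) ≤ pureSpan (⨆ i, supp (γ i)) := by
      rw [Submodule.span_le]
      rintro _ ⟨i, rfl⟩
      exact mem_pureSpan_iff.mpr ⟨hγ.hermitian i, le_iSup (fun i => supp (γ i)) i⟩
    exact (mem_pureSpan_iff.mp (h1 (hγ.spanning ρ hρ.1 hfix))).2
  refine ⟨?_, hle⟩
  have h2 := isStationarySupport_sSup (F := F) (𝓑 := {V | IsStationarySupport F V}) fun _ h => h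
  have h3 : sSup {V | IsStationarySupport F V} = ⨆ i, supp (γ i) := by
    refine le_antisymm (sSup_le hle) (iSup_le fun i => ?_)
    obtain ⟨A, B, hA, hB, hFA, hFB, hAB, -, -⟩ :=
      exists_fixed_posSemidef_sub hF (hγ.hermitian i) (hγ.fixed i)
    rw [hAB]
    exact (supp_sub_le hA.1 hB.1).trans
      (sup_le (le_sSup ⟨A, hA, hFA, rfl⟩) (le_sSup ⟨B, hB, hFB, rfl⟩))
  rwa [h3] at h2

/-- Families of pairwise orthogonal proper BSCC subspaces. -/
def IsOrthogonalBSCCFamily (F : SuperOp n) (𝓒 : Set (Submodule ℂ (EuclideanSpace ℂ n))) : Prop :=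
  (∀ B ∈ 𝓒, IsProperBSCC F B) ∧ 𝓒.Pairwise fun B B' => B ⟂ B'

theorem exists_maximal_isOrthogonalBSCCFamily (F : SuperOp n) :
    ∃ 𝓑, Maximal (IsOrthogonalBSCCFamily F) 𝓑 := by
  refine zorn_subset {𝓒 | IsOrthogonalBSCCFamily F 𝓒} fun c hc hchain =>
    ⟨⋃₀ c, ⟨?_, ?_⟩, fun s hs => Set.subset_sUnion_of_mem hs⟩
  · rintro B ⟨s, hs, hB⟩
    exact (hc hs).1 B hB
  · exact (Set.pairwise_sUnion hchain.directedOn).mpr fun s hs => (hc hs).2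

/-- Nonzero pairwise orthogonal subspaces are independent, and finite dimension allows only finitely
many. -/
theorem IsOrthogonalBSCCFamily.exists_fin {𝓑 : Set (Submodule ℂ (EuclideanSpace ℂ n))}
    (h𝓑 : IsOrthogonalBSCCFamily F 𝓑) :
    ∃ (k : ℕ) (B : Fin k → Submodule ℂ (EuclideanSpace ℂ n)),
      (∀ j, IsProperBSCC F (B j)) ∧ (Pairwise fun i j => B i ⟂ B j) ∧ ⨆ j, B j = sSup 𝓑 := by
  have hind : iSupIndep (fun B : 𝓑 => (B : Submodule ℂ (EuclideanSpace ℂ n))) :=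
    (OrthogonalFamily.of_pairwise fun A B hAB =>
      h𝓑.2 A.2 B.2 (Subtype.coe_ne_coe.mpr hAB)).independent
  have hfin : Finite 𝓑 := WellFoundedGT.finite_of_iSupIndep hind fun B => (h𝓑.1 B B.2).ne_bot
  obtain ⟨k, ⟨e⟩⟩ := Finite.exists_equiv_fin 𝓑
  refine ⟨k, fun j => e.symm j, fun j => h𝓑.1 _ (e.symm j).2, fun i j hij =>
    h𝓑.2 (e.symm i).2 (e.symm j).2 (Subtype.coe_ne_coe.mpr (e.symm.injective.ne hij)), ?_⟩
  rw [sSup_eq_iSup']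
  exact e.symm.iSup_comp (g := fun B : 𝓑 => (B : Submodule ℂ (EuclideanSpace ℂ n)))

theorem sSup_eq_of_maximal (hF : IsSubstochastic F)
    (hB : ∀ B, IsProperBSCC F B → IsStationarySupport F B)
    {Γ : Submodule ℂ (EuclideanSpace ℂ n)} (hΓ : IsStationarySupport F Γ)
    (hle : ∀ V, IsStationarySupport F V → V ≤ Γ) {𝓑 : Set (Submodule ℂ (EuclideanSpace ℂ n))}
    (h𝓑 : Maximal (IsOrthogonalBSCCFamily F) 𝓑) : sSup 𝓑 = Γ := by
  have hs := isStationarySupport_sSup fun B h => hB B (h𝓑.prop.1 B h)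
  have hsΓ := hle _ hs
  have hW := hs.inf_orthogonal hF hΓ hsΓ
  rw [← Submodule.sup_orthogonal_inf_of_hasOrthogonalProjection hsΓ, left_eq_sup]
  by_cases h0 : (sSup 𝓑)ᗮ ⊓ Γ = ⊥
  · rw [h0]; exact bot_le
  exfalso
  obtain ⟨V, hV, -, hVB⟩ := hW.exists_isProperBSCC_le hF h0
  -- The new subspace `V` can be added to the family, so by maximality it is already a member; it is
  -- then orthogonal to itself, hence zero.
  have hperp : V ≤ (sSup 𝓑)ᗮ := hV.trans inf_le_left
  have hVmem : V ∈ 𝓑 := by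
    refine h𝓑.mem_of_prop_insert ⟨?_, ?_⟩
    · rintro B (rfl | h)
      exacts [hVB, h𝓑.prop.1 B h]
    · refine h𝓑.prop.2.insert fun B h _ => ?_
      have h1 : V ⟂ B := (Submodule.isOrtho_iff_le.mpr hperp).mono_right (le_sSup h)
      exact ⟨h1, h1.symm⟩
  have h1 : V ⟂ V := (Submodule.isOrtho_iff_le.mpr hperp).mono_right (le_sSup hVmem)
  exact hVB.ne_bot (Submodule.isOrtho_self.mp h1)

end Decomposition

/-! ### The restricted super-operator of a quantum Markov chain -/

section QMC

variable {S ι : Type*} [Fintype S] [DecidableEq S] [Fintype ι] [DecidableEq ι]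

/-- The one-dimensional extension `k = 1` is the map itself. -/
theorem IsCompletelyPositive.posSemidef_map {E : SuperOp ι} (hE : IsCompletelyPositive E)
    {X : Matrix ι ι ℂ} (hX : X.PosSemidef) : (E X).PosSemidef := by
  have h := (hE 1 (X.submatrix Prod.fst Prod.fst) (hX.submatrix _)).submatrix
    (fun a : ι => (a, (0 : Fin 1)))
  exact h

theorem posSemidef_diagBlock {M : Matrix (S × ι) (S × ι) ℂ} (hM : M.PosSemidef) (s : S) :
    (diagBlock s M).PosSemidef :=
  hM.submatrix fun a => (s, a)

theorem posSemidef_putBlock {X : Matrix ι ι ℂ} (hX : X.PosSemidef) (t : S) :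
    (putBlock t X).PosSemidef := by
  refine Matrix.PosSemidef.kronecker ?_ hX
  have h : (Matrix.single t t (1 : ℂ)) = Matrix.diagonal (Pi.single t 1) := by
    rw [Matrix.diagonal_single]
  rw [h]
  exact Matrix.PosSemidef.diagonal (Pi.single_nonneg.mpr zero_le_one)

theorem trace_putBlock (X : Matrix ι ι ℂ) (t : S) : (putBlock t X).trace = X.trace := by
  change (Matrix.single t t (1 : ℂ) ⊗ₖ X).trace = _
  rw [Matrix.trace_kronecker, Matrix.trace_single_eq_same, one_mul]

theorem sum_trace_diagBlock (M : Matrix (S × ι) (S × ι) ℂ) :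
    ∑ s, (diagBlock s M).trace = M.trace :=
  (Fintype.sum_prod_type fun x => M x x).symm

/-- The pre-order tests only partial density operators; normalizing by the trace reaches all
positive ones. -/
theorem TraceEquiv.trace_re_eq {E : SuperOp ι} (h : TraceEquiv E 1) {X : Matrix ι ι ℂ}
    (hX : X.PosSemidef) : (E X).trace.re = X.trace.re := by
  set c := X.trace.re with hc
  have hc0 : 0 ≤ c := trace_re_nonneg hX
  rcases hc0.eq_or_lt with h0 | hpos
  · rw [eq_zero_of_trace_re_nonpos hX h0.symm.le, map_zero, Matrix.trace_zero, Complex.zero_re, h0]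
  · have hd : IsPartialDensity (c⁻¹ • X) := by
      refine ⟨posSemidef_real_smul hX (inv_nonneg.mpr hc0), ?_⟩
      rw [trace_re_real_smul, ← hc, inv_mul_cancel₀ hpos.ne']
    have h1 : (E (c⁻¹ • X)).trace.re = (c⁻¹ • X).trace.re := le_antisymm (h.1 _ hd) (h.2 _ hd)
    rw [map_real_smul, trace_re_real_smul, trace_re_real_smul] at h1
    exact mul_left_cancel₀ (inv_ne_zero hpos.ne') h1

theorem QMC.combined_apply (C : QMC S ι) (M : Matrix (S × ι) (S × ι) ℂ) :
    C.combined M = ∑ s, ∑ t, putBlock t (C.Q s t (diagBlock s M)) := by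
  simp [QMC.combined, LinearMap.sum_apply, jump]

theorem QMC.posSemidef_combined (C : QMC S ι) {M : Matrix (S × ι) (S × ι) ℂ}
    (hM : M.PosSemidef) : (C.combined M).PosSemidef := by
  rw [C.combined_apply]
  exact Matrix.posSemidef_sum _ fun s _ => Matrix.posSemidef_sum _ fun t _ =>
    posSemidef_putBlock ((C.completelyPositive s t).posSemidef_map (posSemidef_diagBlock hM s)) t

theorem QMC.trace_combined (C : QMC S ι) {M : Matrix (S × ι) (S × ι) ℂ}
    (hM : M.PosSemidef) : (C.combined M).trace.re = M.trace.re := by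
  rw [C.combined_apply, ← sum_trace_diagBlock M, Matrix.trace_sum, Complex.re_sum, Complex.re_sum]
  refine Finset.sum_congr rfl fun s _ => ?_
  rw [← (C.complete s).trace_re_eq (posSemidef_diagBlock hM s), Matrix.trace_sum,
    LinearMap.sum_apply, Matrix.trace_sum]
  simp only [trace_putBlock]

open Classical in
theorem stateProjector_eq_diagonal (Φ : S → Prop) :
    (stateProjector Φ : Matrix (S × ι) (S × ι) ℂ)
      = Matrix.diagonal fun x => if Φ x.1 then 1 else 0 := by
  have h : (∑ s ∈ Finset.univ.filter Φ, Matrix.single s s (1 : ℂ))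
      = Matrix.diagonal fun s => if Φ s then 1 else 0 := by
    ext a b
    rw [Matrix.sum_apply, Matrix.diagonal_apply]
    simp only [Matrix.single_apply]
    by_cases hab : a = b
    · subst hab
      simp
    · rw [if_neg hab]
      refine Finset.sum_eq_zero fun s _ => if_neg ?_
      rintro ⟨rfl, rfl⟩
      exact hab rfl
  rw [stateProjector, h, ← Matrix.diagonal_one, Matrix.diagonal_kronecker_diagonal]
  simp

theorem isHermitian_stateProjector (Φ : S → Prop) :
    (stateProjector Φ : Matrix (S × ι) (S × ι) ℂ).IsHermitian := by
  classical
  rw [stateProjector_eq_diagonal, Matrix.isHermitian_diagonal_iff]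
  intro x
  split_ifs
  exacts [IsSelfAdjoint.one ℂ, IsSelfAdjoint.zero ℂ]

theorem stateProjector_mul_self (Φ : S → Prop) :
    (stateProjector Φ : Matrix (S × ι) (S × ι) ℂ) * stateProjector Φ = stateProjector Φ := by
  classical
  simp [stateProjector_eq_diagonal, Matrix.diagonal_mul_diagonal]

-- The projector is constant on each state block and `putBlock` is block diagonal. Hence all outputs
-- of the restricted map commute with the projector.
open Classical in
theorem stateProjector_mul_putBlock (Φ : S → Prop) (t : S) (X : Matrix ι ι ℂ) :
    stateProjector Φ * putBlock t X = putBlock t X * stateProjector Φ := by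
  rw [stateProjector_eq_diagonal]
  ext ⟨a, i⟩ ⟨b, j⟩
  rw [Matrix.diagonal_mul, Matrix.mul_diagonal]
  change _ * (Matrix.single t t (1 : ℂ) a b * X i j) = (Matrix.single t t (1 : ℂ) a b * X i j) * _
  by_cases hab : a = b
  · subst hab; exact mul_comm _ _
  · have h0 : Matrix.single t t (1 : ℂ) a b = 0 :=
      if_neg (by rintro ⟨rfl, rfl⟩; exact hab rfl)
    rw [h0, zero_mul, mul_zero, zero_mul]

theorem QMC.restricted_apply (C : QMC S ι) (Φ : S → Prop) (M : Matrix (S × ι) (S × ι) ℂ) :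
    C.restricted Φ M = C.combined (stateProjector Φ * M * stateProjector Φ) := by
  rw [QMC.restricted, projection, (isHermitian_stateProjector Φ).eq]
  simp [mul_assoc]

theorem QMC.isSubstochastic_restricted (C : QMC S ι) (Φ : S → Prop) :
    IsSubstochastic (C.restricted Φ) := by
  have hP := isHermitian_stateProjector (ι := ι) Φ
  refine ⟨fun X hX => ?_, fun X hX => ?_⟩
  · rw [C.restricted_apply]
    exact C.posSemidef_combined (posSemidef_conj hX hP)
  · rw [C.restricted_apply, C.trace_combined (posSemidef_conj hX hP),
      trace_eq_add_conj (stateProjector_mul_self Φ) X]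
    exact le_add_of_nonneg_right (trace_re_nonneg (posSemidef_conj hX (isHermitian_one_sub hP)))

/-- The unrestricted map preserves the trace of positive operators, so loss comes only from the
projector: it kills pure states on its kernel and leaves those in its range unchanged. -/
theorem QMC.isStationarySupport_of_isProperBSCC (C : QMC S ι) (Φ : S → Prop)
    {B : Submodule ℂ (EuclideanSpace ℂ (S × ι))} (hB : IsProperBSCC (C.restricted Φ) B) :
    IsStationarySupport (C.restricted Φ) B := by
  have hP := isHermitian_stateProjector (ι := ι) Φ
  have hconj : ∀ φ : EuclideanSpace ℂ (S × ι),
      stateProjector Φ * ketbra φ * stateProjector Φ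
        = ketbra (Matrix.toEuclideanLin (stateProjector Φ) φ) := by
    intro φ
    rw [← mul_ketbra_mul, hP.eq]
  refine hB.isStationarySupport (C.isSubstochastic_restricted Φ) (stateProjector_mul_self Φ)
    (fun X => ?_) (fun φ hφ => ?_) (fun φ hφ => ?_)
  · rw [C.restricted_apply, C.combined_apply]
    simp only [Finset.mul_sum, Finset.sum_mul, stateProjector_mul_putBlock]
  · rw [C.restricted_apply, hconj, hφ, ketbra_zero, map_zero]
  · rw [C.restricted_apply, hconj, hφ, C.trace_combined (posSemidef_ketbra φ)]

end QMC

end QMarkov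

end

theorem mainTheorem3 {S ι : Type*} [Fintype S] [DecidableEq S] [Fintype ι] [DecidableEq ι]
    (C : QMarkov.QMC S ι) (Φ₁ Φ₂ : S → Prop)
    (F : QMarkov.SuperOp (S × ι)) (hF : F = C.restricted (fun s => Φ₁ s ∧ ¬ Φ₂ s))
    (m : ℕ) (γ : Fin m → Matrix (S × ι) (S × ι) ℂ) (hγ : QMarkov.IsSolutionBasis F γ)
    (Γ : Submodule ℂ (EuclideanSpace ℂ (S × ι)))
    (hΓ : Γ = Submodule.span ℂ
      (⋃ i : Fin m, (QMarkov.supp (γ i) : Set (EuclideanSpace ℂ (S × ι))))) :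
    -- the sum of all BSCC subspaces is `Γ`
    sSup {B : Submodule ℂ (EuclideanSpace ℂ (S × ι)) | QMarkov.IsProperBSCC F B} = Γ ∧
    -- `Γ` is an orthogonal direct sum of BSCC subspaces
    (∃ (k : ℕ) (B : Fin k → Submodule ℂ (EuclideanSpace ℂ (S × ι))),
      (∀ j, QMarkov.IsProperBSCC F (B j)) ∧ (Pairwise fun i j => B i ⟂ B j) ∧ ⨆ j, B j = Γ) ∧
    -- every maximal family of pairwise orthogonal BSCC subspaces has the direct sum `Γ`
    (∀ 𝓑 : Set (Submodule ℂ (EuclideanSpace ℂ (S × ι))),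
      Maximal (fun 𝓒 : Set (Submodule ℂ (EuclideanSpace ℂ (S × ι))) =>
        (∀ B ∈ 𝓒, QMarkov.IsProperBSCC F B) ∧ 𝓒.Pairwise fun B B' => B ⟂ B') 𝓑 →
      sSup 𝓑 = Γ) := by
  subst hF hΓ
  have hF := C.isSubstochastic_restricted fun s => Φ₁ s ∧ ¬ Φ₂ s
  have hB := fun B => C.isStationarySupport_of_isProperBSCC (fun s => Φ₁ s ∧ ¬ Φ₂ s) (B := B)
  obtain ⟨hΓ, hle⟩ := QMarkov.isStationarySupport_span_supp hF hγ
  obtain ⟨𝓑, h𝓑⟩ := QMarkov.exists_maximal_isOrthogonalBSCCFamily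
    (C.restricted fun s => Φ₁ s ∧ ¬ Φ₂ s)
  have hsup := QMarkov.sSup_eq_of_maximal hF hB hΓ hle h𝓑
  refine ⟨le_antisymm (sSup_le fun B h => hle B (hB B h)) ?_, ?_, fun 𝓒 h𝓒 =>
    QMarkov.sSup_eq_of_maximal hF hB hΓ hle h𝓒⟩
  · rw [← hsup]
    exact sSup_le_sSup h𝓑.prop.1
  · rw [← hsup]
    exact h𝓑.prop.exists_fin
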